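/- Let $\gamma:\mathbb{R}\to\mathbb{R}^3$ be an analytic $\mathbb{Z}$-periodic map with nowhere vanishing derivative which is injective on $[0,1)$, so that it parameterizes a knot. Call a 6-tuple $(x_1,\dots,x_6)$ of points of $\mathbb{R}^3$ a trefoil if the closed polygonal path obtained by cyclically connecting $x_1,\dots,x_6$ by line segments is simple and is a trefoil knot (of either handedness), that is, some homeomorphism of $\mathbb{R}^3$ carries it onto a standard trefoil knot. A 6-tuple of points of $S^3$ is a stereographic trefoil if it lies on some 2-sphere in $S^3$ (the intersection of the unit sphere $S^3\subset\mathbb{R}^4$ with an affine hyperplane) and if there is a stereographic projection $S^3\setminus\{v\}\to\mathbb{R}^3$, with pole $v$ different from all six points, whose images of the six points lie on a common round sphere in $\mathbb{R}^3$ and form a trefoil. A 6-tuple in $\mathbb{R}^3$ is called a stereographic trefoil if its image in $S^3$ under inverse stereographic projection is one. If $P$ is a plane and $\gamma(t)\in P$, then $\gamma(t)$ is a one-sided intersection point of $\gamma$ with $P$ if there is an open interval $I\ni t$ such that $\gamma(I)$ contains points on one of the two sides of $P$ but no points on the other side. Suppose that $t_1<\dots<t_6<t_1+1$ are real numbers such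 that the points $\gamma(t_1),\dots,\gamma(t_6)$ lie in a plane $P$ that does not contain the whole curve $\gamma$, the 6-tuple $(\gamma(t_1),\dots,\gamma(t_6))$ is a stereographic trefoil, and at most three of the six points are one-sided intersection points of $\gamma$ with $P$. Then for every $\varepsilon>0$ there exist real numbers $t_1'<\dots<t_6'<t_1'+1$ with $|t_i'-t_i|<\varepsilon$ for $i=1,\dots,6$ such that $(\gamma(t_1'),\dots,\gamma(t_6'))$ is a trefoil. -/

import Mathlib

noncomputable section

namespace InscribedTrefoil

/-- Euclidean 3-space. -/
abbrev E3 : Type := EuclideanSpace ℝ (Fin 3)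

/-- Euclidean 4-space. -/
abbrev E4 : Type := EuclideanSpace ℝ (Fin 4)

/-- The round 3-sphere, as the unit sphere of Euclidean 4-space. -/
abbrev S3 : Type := Metric.sphere (0 : E4) 1

instance factFinrankE4 : Fact (Module.finrank ℝ E4 = 3 + 1) := ⟨by simp⟩

/-! ### Trefoil knots -/

/-- The standard trefoil: the `(2, 3)` torus knot on a torus of revolution. -/
def standardTrefoil : Set E3 :=
  Set.range fun θ : ℝ =>
    !₂[(2 + Real.cos (3 * θ)) * Real.cos (2 * θ),
       (2 + Real.cos (3 * θ)) * Real.sin (2 * θ),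
       Real.sin (3 * θ)]

/-- A subset of `ℝ³` is a trefoil knot (of either handedness) if some homeomorphism of `ℝ³`
carries it onto the standard trefoil. -/
def IsTrefoilKnot (K : Set E3) : Prop :=
  ∃ h : E3 ≃ₜ E3, h '' K = standardTrefoil

/-- The closed hexagon with vertices `x 0, …, x 5` in this cyclic order. -/
def hexagon (x : Fin 6 → E3) : Polygon E3 6 := ⟨x⟩

/-- The closed polygonal path through `x 0, …, x 5` does not meet itself: the vertices are
distinct, and two different edges meet at most in a common vertex. -/
def IsSimpleHexagon (x : Fin 6 → E3) : Prop :=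
  Function.Injective x ∧
    ∀ i j : Fin 6, i ≠ j →
      (hexagon x).edgeSet ℝ i ∩ (hexagon x).edgeSet ℝ j ⊆
        ({x i, x (i + 1)} : Set E3) ∩ {x j, x (j + 1)}

/-- Cyclically connecting the six points by line segments, in the given order, gives a
trefoil knot. -/
def IsTrefoilHexagon (x : Fin 6 → E3) : Prop :=
  IsSimpleHexagon x ∧ IsTrefoilKnot ((hexagon x).boundary ℝ)

/-- A spherical trefoil knot: six points on a common round sphere of `ℝ³` which give a trefoil
knot when connected cyclically. -/
def IsSphericalTrefoil (x : Fin 6 → E3) : Prop :=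
  EuclideanGeometry.Cospherical (Set.range x) ∧ IsTrefoilHexagon x

/-- The points lie on a common 2-sphere of `S³`, that is, on the intersection of `S³` with an
affine hyperplane of `ℝ⁴`. -/
def LieOnTwoSphere (X : Fin 6 → S3) : Prop :=
  ∃ H : AffineSubspace ℝ E4, Module.finrank ℝ H.direction = 3 ∧ ∀ i, (X i : E4) ∈ H

/-- A stereographic trefoil in `S³`: six points on a common 2-sphere which form a spherical
trefoil knot under the stereographic projection from some pole different from all of them. -/
def IsStereographicTrefoil (X : Fin 6 → S3) : Prop :=
  LieOnTwoSphere X ∧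
    ∃ v : S3, (∀ i, X i ≠ v) ∧ IsSphericalTrefoil fun i => stereographic' 3 v (X i)

/-- The pole used to regard `ℝ³` as a subset of `S³`. -/
def northPole : S3 := ⟨EuclideanSpace.single 3 1, by simp⟩

/-- The inclusion of `ℝ³` in `S³` given by inverse stereographic projection. -/
def toS3 (p : E3) : S3 := (stereographic' 3 northPole).symm p

/-! ### Analytic curves and their position with respect to a plane -/

/-- `γ` is an analytic `ℤ`-periodic parameterization, with nowhere vanishing derivative, of a
knot in `ℝ³`. -/
structure IsAnalyticKnot (γ : ℝ → E3) : Prop where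
  analytic : AnalyticOnNhd ℝ γ Set.univ
  periodic : Function.Periodic γ 1
  deriv_ne_zero : ∀ t, deriv γ t ≠ 0
  injOn : Set.InjOn γ (Set.Ico 0 1)

/-- An oriented plane `{p | ⟪normal, p⟫ = offset}` in `ℝ³`; its top side is the one to which the
normal vector points. -/
structure OrientedPlane where
  normal : E3
  offset : ℝ
  normal_ne_zero : normal ≠ 0

namespace OrientedPlane

/-- The points of the plane. -/
def carrier (P : OrientedPlane) : Set E3 := {p | inner ℝ P.normal p = P.offset}

/-- The top side of the plane. -/
def top (P : OrientedPlane) : Set E3 := {p | P.offset < inner ℝ P.normal p}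

/-- The bottom side of the plane. -/
def bottom (P : OrientedPlane) : Set E3 := {p | inner ℝ P.normal p < P.offset}

/-- `γ t` is a positive one-sided intersection point of `γ` with `P`. -/
def PositiveOneSided (P : OrientedPlane) (γ : ℝ → E3) (t : ℝ) : Prop :=
  γ t ∈ P.carrier ∧ ∃ a b : ℝ, a < t ∧ t < b ∧
    (∃ s ∈ Set.Ioo a b, γ s ∈ P.top) ∧ ∀ s ∈ Set.Ioo a b, γ s ∉ P.bottom

/-- `γ t` is a negative one-sided intersection point of `γ` with `P`. -/
def NegativeOneSided (P : OrientedPlane) (γ : ℝ → E3) (t : ℝ) : Prop :=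
  γ t ∈ P.carrier ∧ ∃ a b : ℝ, a < t ∧ t < b ∧
    (∃ s ∈ Set.Ioo a b, γ s ∈ P.bottom) ∧ ∀ s ∈ Set.Ioo a b, γ s ∉ P.top

/-- `γ t` is a one-sided intersection point of `γ` with `P`. -/
def OneSided (P : OrientedPlane) (γ : ℝ → E3) (t : ℝ) : Prop :=
  P.PositiveOneSided γ t ∨ P.NegativeOneSided γ t

end OrientedPlane

end InscribedTrefoil

end

namespace InscribedTrefoil

/-- The point with parameter `s` on the `i`-th edge of the closed hexagon with vertices `x`. -/
def edgePoint (x : Fin 6 → E3) (i : Fin 6) (s : ℝ) : E3 := (1 - s) • x i + s • x (i + 1)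

theorem edgeSet_hexagon (x : Fin 6 → E3) (i : Fin 6) :
    (hexagon x).edgeSet ℝ i = edgePoint x i '' Set.Icc 0 1 := by
  rw [Polygon.edgeSet_eq_image_edgePath]
  refine Set.image_congr fun s _ => ?_
  simp [Polygon.edgePath, hexagon, edgePoint, AffineMap.lineMap_apply_module]

/-- A homeomorphism of `ℝ³` taking each edge of one hexagon onto the corresponding edge of a
trefoil hexagon shows that the former is a trefoil as well. -/
theorem IsTrefoilHexagon.of_homeomorph {x y : Fin 6 → E3} (hx : IsTrefoilHexagon x)
    (Φ : E3 ≃ₜ E3) (hv : ∀ i, Φ (y i) = x i)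
    (he : ∀ i, Φ '' (hexagon y).edgeSet ℝ i = (hexagon x).edgeSet ℝ i) :
    IsTrefoilHexagon y := by
  obtain ⟨⟨hinj, hsimple⟩, h, hh⟩ := hx
  refine ⟨⟨fun i j hij => hinj ?_, fun i j hij z hz => ?_⟩, Φ.trans h, ?_⟩
  · rw [← hv, ← hv, hij]
  · have hz' : Φ z ∈ (hexagon x).edgeSet ℝ i ∩ (hexagon x).edgeSet ℝ j := by
      rw [← he, ← he]
      exact ⟨Set.mem_image_of_mem _ hz.1, Set.mem_image_of_mem _ hz.2⟩
    simpa [← hv] using hsimple i j hij hz'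
  · have : Φ '' (hexagon y).boundary ℝ = (hexagon x).boundary ℝ := by
      simp only [Polygon.boundary, Set.image_iUnion, he]
    rw [← hh, ← this, Set.image_image]
    rfl

/-- A homeomorphism matching two hexagons linearly along the edges transports trefoils. -/
theorem IsTrefoilHexagon.map_edgePoint {x y : Fin 6 → E3} (hx : IsTrefoilHexagon x)
    (Φ : E3 ≃ₜ E3)
    (hΦ : ∀ i, ∀ s ∈ Set.Icc (0 : ℝ) 1, Φ (edgePoint x i s) = edgePoint y i s) :
    IsTrefoilHexagon y := by
  have himg : ∀ i, Φ '' (edgePoint x i '' Set.Icc 0 1) = edgePoint y i '' Set.Icc 0 1 := by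
    intro i
    rw [Set.image_image]
    exact Set.image_congr (hΦ i)
  refine hx.of_homeomorph Φ.symm (fun i => ?_) (fun i => ?_)
  · rw [Homeomorph.symm_apply_eq]
    simpa [edgePoint] using (hΦ i 0 (by simp)).symm
  · rw [edgeSet_hexagon, edgeSet_hexagon, ← himg, Set.image_image]
    simp

theorem exists_pos_mul_add_le_norm_sub {E : Type*} [NormedAddCommGroup E] [NormedSpace ℝ E]
    {u w : E}
    (h : ∀ s ∈ Set.Icc (0 : ℝ) 1, ∀ t ∈ Set.Icc (0 : ℝ) 1, s • u = t • w → s = 0 ∧ t = 0) :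
    ∃ c > 0, ∀ s t : ℝ, 0 ≤ s → 0 ≤ t → c * (s + t) ≤ ‖s • u - t • w‖ := by
  obtain ⟨r, hr, hmin⟩ := (isCompact_Icc (a := (0 : ℝ)) (b := 1)).exists_isMinOn
    ⟨0, by simp⟩ (f := fun r => ‖r • u - (1 - r) • w‖) (by fun_prop)
  refine ⟨‖r • u - (1 - r) • w‖, ?_, fun s t hs ht => ?_⟩
  · rw [gt_iff_lt, norm_pos_iff, sub_ne_zero]
    intro he
    have := h r hr (1 - r) ⟨by linarith [hr.2], by linarith [hr.1]⟩ he
    linarith [this.1, this.2]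
  · rcases (add_nonneg hs ht).eq_or_lt with h0 | h0
    · rw [← h0]; simp
    · have h1 := hmin (show s / (s + t) ∈ Set.Icc (0 : ℝ) 1 from
        ⟨by positivity, (div_le_one h0).2 (by linarith)⟩)
      simp only [Set.mem_ofPred_eq] at h1
      have h2 : s • u - t • w = (s + t) • ((s / (s + t)) • u - (1 - s / (s + t)) • w) := by
        rw [smul_sub, smul_smul, smul_smul, mul_div_cancel₀ _ h0.ne', mul_sub,
          mul_div_cancel₀ _ h0.ne']
        simp
      rw [h2, norm_smul, Real.norm_of_nonneg h0.le, mul_comm]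
      gcongr

theorem norm_edgePoint_le {d : Fin 6 → E3} {D : ℝ} (hd : ∀ i, ‖d i‖ ≤ D) (i : Fin 6) {s : ℝ}
    (hs : s ∈ Set.Icc (0 : ℝ) 1) : ‖edgePoint d i s‖ ≤ D := by
  have hs' : 0 ≤ 1 - s := by linarith [hs.2]
  calc ‖edgePoint d i s‖ ≤ ‖(1 - s) • d i‖ + ‖s • d (i + 1)‖ := norm_add_le _ _
    _ = (1 - s) * ‖d i‖ + s * ‖d (i + 1)‖ := by
        rw [norm_smul, norm_smul, Real.norm_of_nonneg hs', Real.norm_of_nonneg hs.1]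
    _ ≤ (1 - s) * D + s * D :=
        add_le_add (mul_le_mul_of_nonneg_left (hd _) hs') (mul_le_mul_of_nonneg_left (hd _) hs.1)
    _ = D := by ring

theorem edgePoint_sub_edgePoint_succ (x : Fin 6 → E3) (i : Fin 6) (s t : ℝ) :
    edgePoint x i s - edgePoint x (i + 1) t =
      (1 - s) • (x i - x (i + 1)) - t • (x (i + 1 + 1) - x (i + 1)) := by
  simp only [edgePoint]
  module

theorem IsSimpleHexagon.exists_chord_bound_succ {x : Fin 6 → E3} (hx : IsSimpleHexagon x)
    (i : Fin 6) :
    ∃ C : ℝ, 0 ≤ C ∧ ∀ (d : Fin 6 → E3) (D : ℝ), (∀ k, ‖d k‖ ≤ D) →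
      ∀ s ∈ Set.Icc (0 : ℝ) 1, ∀ t ∈ Set.Icc (0 : ℝ) 1,
        ‖edgePoint d i s - edgePoint d (i + 1) t‖ ≤
          C * D * ‖edgePoint x i s - edgePoint x (i + 1) t‖ := by
  obtain ⟨hinj, hsimple⟩ := hx
  have h02 : i ≠ i + 1 + 1 := by decide +revert
  have h01 : i ≠ i + 1 := by decide +revert
  have h12 : i + 1 ≠ i + 1 + 1 := by decide +revert
  obtain ⟨c, hc, hbound⟩ := exists_pos_mul_add_le_norm_sub
    (u := x i - x (i + 1)) (w := x (i + 1 + 1) - x (i + 1)) (by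
      intro s hs t ht hst
      have heq : edgePoint x i (1 - s) = edgePoint x (i + 1) t := by
        rw [← sub_eq_zero, edgePoint_sub_edgePoint_succ, sub_sub_cancel, hst, sub_self]
      have hmem := hsimple i (i + 1) h01 (a := edgePoint x (i + 1) t)
        ⟨by rw [edgeSet_hexagon, ← heq]
            exact ⟨1 - s, ⟨by linarith [hs.2], by linarith [hs.1]⟩, rfl⟩,
         by rw [edgeSet_hexagon]; exact ⟨t, ht, rfl⟩⟩
      have hvert : edgePoint x (i + 1) t = x (i + 1) := by
        rcases hmem with ⟨h1 | h1, h2 | h2⟩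
        · exact h2
        · rw [Set.mem_singleton_iff.1 h2] at h1
          exact absurd (hinj h1).symm h02
        · exact h2
        · exact h1
      have ht0 : t • (x (i + 1 + 1) - x (i + 1)) = 0 := by
        rw [← sub_eq_zero.2 hvert]
        simp only [edgePoint]
        module
      have hs0 : s • (x i - x (i + 1)) = 0 := hst.trans ht0
      rw [smul_eq_zero, sub_eq_zero] at ht0 hs0
      exact ⟨hs0.resolve_right fun h => h01 (hinj h),
        ht0.resolve_right fun h => h12 (hinj h).symm⟩)
  refine ⟨2 / c, by positivity, fun d D hd s hs t ht => ?_⟩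
  have hs' : 0 ≤ 1 - s := by linarith [hs.2]
  have hD : 0 ≤ D := (norm_nonneg _).trans (hd 0)
  have h2 : ∀ k l, ‖d k - d l‖ ≤ 2 * D := fun k l =>
    (norm_sub_le _ _).trans (by linarith [hd k, hd l])
  have hb := hbound (1 - s) t hs' ht.1
  rw [edgePoint_sub_edgePoint_succ, edgePoint_sub_edgePoint_succ]
  calc ‖(1 - s) • (d i - d (i + 1)) - t • (d (i + 1 + 1) - d (i + 1))‖
      ≤ ‖(1 - s) • (d i - d (i + 1))‖ + ‖t • (d (i + 1 + 1) - d (i + 1))‖ := norm_sub_le _ _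
    _ = (1 - s) * ‖d i - d (i + 1)‖ + t * ‖d (i + 1 + 1) - d (i + 1)‖ := by
        rw [norm_smul, norm_smul, Real.norm_of_nonneg hs', Real.norm_of_nonneg ht.1]
    _ ≤ (1 - s) * (2 * D) + t * (2 * D) :=
        add_le_add (mul_le_mul_of_nonneg_left (h2 _ _) hs') (mul_le_mul_of_nonneg_left (h2 _ _) ht.1)
    _ = 2 / c * D * (c * (1 - s + t)) := by field_simp
    _ ≤ _ := by gcongr

theorem IsSimpleHexagon.exists_chord_bound_of_disjoint {x : Fin 6 → E3}
    (hx : IsSimpleHexagon x) {i j : Fin 6} (h0 : i ≠ j) (h1 : j ≠ i + 1) (h2 : i ≠ j + 1) :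
    ∃ C : ℝ, 0 ≤ C ∧ ∀ (d : Fin 6 → E3) (D : ℝ), (∀ k, ‖d k‖ ≤ D) →
      ∀ s ∈ Set.Icc (0 : ℝ) 1, ∀ t ∈ Set.Icc (0 : ℝ) 1,
        ‖edgePoint d i s - edgePoint d j t‖ ≤ C * D * ‖edgePoint x i s - edgePoint x j t‖ := by
  obtain ⟨hinj, hsimple⟩ := hx
  obtain ⟨⟨a, b⟩, hab, hmin⟩ := ((isCompact_Icc (a := (0 : ℝ)) (b := 1)).prod
    (isCompact_Icc (a := (0 : ℝ)) (b := 1))).exists_isMinOn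
    ⟨(0, 0), by simp⟩ (f := fun r : ℝ × ℝ => ‖edgePoint x i r.1 - edgePoint x j r.2‖)
    (by unfold edgePoint; fun_prop)
  obtain ⟨m, hm⟩ : ∃ m, m = ‖edgePoint x i a - edgePoint x j b‖ := ⟨_, rfl⟩
  have hmpos : 0 < m := by
    rw [hm, norm_pos_iff, sub_ne_zero]
    intro heq
    have hmem := hsimple i j h0 (a := edgePoint x i a)
      ⟨by rw [edgeSet_hexagon]; exact ⟨a, hab.1, rfl⟩,
       by rw [edgeSet_hexagon, heq]; exact ⟨b, hab.2, rfl⟩⟩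
    have key : ∀ k l, k ≠ l → edgePoint x i a = x k → edgePoint x i a ≠ x l :=
      fun k l hkl h h' => hkl (hinj (h.symm.trans h'))
    rcases hmem with ⟨h | h, h' | h'⟩
    · exact key _ _ h0 h h'
    · exact key _ _ h2 h h'
    · exact key _ _ h1.symm h h'
    · exact key _ _ (fun e => h0 (add_right_cancel e)) h h'
  refine ⟨2 / m, by positivity, fun d D hd s hs t ht => ?_⟩
  have hD : 0 ≤ D := (norm_nonneg _).trans (hd 0)
  have hb : m ≤ ‖edgePoint x i s - edgePoint x j t‖ :=
    hm.trans_le (isMinOn_iff.1 hmin (s, t) ⟨hs, ht⟩)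
  calc ‖edgePoint d i s - edgePoint d j t‖ ≤ ‖edgePoint d i s‖ + ‖edgePoint d j t‖ :=
        norm_sub_le _ _
    _ ≤ D + D := add_le_add (norm_edgePoint_le hd i hs) (norm_edgePoint_le hd j ht)
    _ = 2 / m * D * m := by field_simp; ring
    _ ≤ _ := by gcongr

theorem IsSimpleHexagon.exists_chord_bound_self {x : Fin 6 → E3}
    (hx : IsSimpleHexagon x) (i : Fin 6) :
    ∃ C : ℝ, 0 ≤ C ∧ ∀ (d : Fin 6 → E3) (D : ℝ), (∀ k, ‖d k‖ ≤ D) →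
      ∀ s t : ℝ,
        ‖edgePoint d i s - edgePoint d i t‖ ≤ C * D * ‖edgePoint x i s - edgePoint x i t‖ := by
  have h01 : i + 1 ≠ i := by decide +revert
  have hpos : 0 < ‖x (i + 1) - x i‖ := norm_pos_iff.2 (sub_ne_zero.2 fun h => h01 (hx.1 h))
  have key : ∀ (y : Fin 6 → E3) (s t : ℝ),
      ‖edgePoint y i s - edgePoint y i t‖ = |s - t| * ‖y (i + 1) - y i‖ := by
    intro y s t
    rw [← Real.norm_eq_abs, ← norm_smul]
    congr 1
    simp only [edgePoint]
    module
  refine ⟨2 / ‖x (i + 1) - x i‖, by positivity, fun d D hd s t => ?_⟩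
  rw [key, key]
  have h2 : ‖d (i + 1) - d i‖ ≤ 2 * D := (norm_sub_le _ _).trans (by linarith [hd (i + 1), hd i])
  calc |s - t| * ‖d (i + 1) - d i‖ ≤ |s - t| * (2 * D) := by gcongr
    _ = _ := by field_simp

/-- A displacement of the vertices of a simple hexagon, interpolated linearly along the edges, is
Lipschitz with a constant controlled by the size of the displacement. -/
theorem IsSimpleHexagon.exists_chord_bound {x : Fin 6 → E3} (hx : IsSimpleHexagon x) :
    ∃ C : ℝ, 0 ≤ C ∧ ∀ (d : Fin 6 → E3) (D : ℝ), (∀ k, ‖d k‖ ≤ D) →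
      ∀ i j : Fin 6, ∀ s ∈ Set.Icc (0 : ℝ) 1, ∀ t ∈ Set.Icc (0 : ℝ) 1,
        ‖edgePoint d i s - edgePoint d j t‖ ≤ C * D * ‖edgePoint x i s - edgePoint x j t‖ := by
  have hpair : ∀ q : Fin 6 × Fin 6, ∃ C : ℝ, 0 ≤ C ∧
      ∀ (d : Fin 6 → E3) (D : ℝ), (∀ k, ‖d k‖ ≤ D) →
      ∀ s ∈ Set.Icc (0 : ℝ) 1, ∀ t ∈ Set.Icc (0 : ℝ) 1,
        ‖edgePoint d q.1 s - edgePoint d q.2 t‖ ≤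
          C * D * ‖edgePoint x q.1 s - edgePoint x q.2 t‖ := by
    rintro ⟨i, j⟩
    by_cases h0 : i = j
    · subst h0
      obtain ⟨C, hC, h⟩ := hx.exists_chord_bound_self i
      exact ⟨C, hC, fun d D hd s _ t _ => h d D hd s t⟩
    by_cases h1 : j = i + 1
    · subst h1
      exact hx.exists_chord_bound_succ i
    by_cases h2 : i = j + 1
    · subst h2
      obtain ⟨C, hC, h⟩ := hx.exists_chord_bound_succ j
      refine ⟨C, hC, fun d D hd s hs t ht => ?_⟩
      rw [norm_sub_rev, norm_sub_rev (edgePoint x _ s)]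
      exact h d D hd t ht s hs
    exact hx.exists_chord_bound_of_disjoint h0 h1 h2
  choose C hC h using hpair
  refine ⟨∑ q, C q, Finset.sum_nonneg fun q _ => hC q, fun d D hd i j s hs t ht => ?_⟩
  have hD : 0 ≤ D := (norm_nonneg _).trans (hd 0)
  refine (h (i, j) d D hd s hs t ht).trans ?_
  gcongr
  exact Finset.single_le_sum (f := C) (fun q _ => hC q) (Finset.mem_univ (i, j))

/-- Adding a contraction to the identity gives a homeomorphism. -/
theorem exists_homeomorph_id_add {E : Type*} [NormedAddCommGroup E] [NormedSpace ℝ E]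
    [CompleteSpace E] {φ : E → E} {K : NNReal} (hφ : LipschitzWith K φ) (hK : K < 1) :
    ∃ Φ : E ≃ₜ E, ∀ z, Φ z = z + φ z := by
  have happ : ApproximatesLinearOn (fun z => z + φ z)
      ((ContinuousLinearEquiv.refl ℝ E : E ≃L[ℝ] E) : E →L[ℝ] E) Set.univ K := by
    rw [ApproximatesLinearOn.approximatesLinearOn_iff_lipschitzOnWith]
    have : (fun z => z + φ z) - ⇑((ContinuousLinearEquiv.refl ℝ E : E ≃L[ℝ] E) : E →L[ℝ] E) = φ := by
      ext z; simp
    rw [this]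
    exact hφ.lipschitzOnWith
  rcases subsingleton_or_nontrivial E with hE | hE
  · exact ⟨happ.toHomeomorph _ (Or.inl hE), fun z => rfl⟩
  · refine ⟨happ.toHomeomorph _ (Or.inr ?_), fun z => rfl⟩
    have : ‖((ContinuousLinearEquiv.refl ℝ E).symm : E →L[ℝ] E)‖₊ = 1 := by
      ext
      exact ContinuousLinearMap.norm_id
    rw [this]
    simpa using hK

/-- Being a trefoil is stable under small perturbations of the vertices. -/
theorem IsTrefoilHexagon.exists_stable {x : Fin 6 → E3} (hx : IsTrefoilHexagon x) :
    ∃ ρ > 0, ∀ y : Fin 6 → E3, (∀ i, ‖y i - x i‖ ≤ ρ) → IsTrefoilHexagon y := by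
  obtain ⟨C, hC, hbound⟩ := hx.1.exists_chord_bound
  set L : ℝ := ↑(lipschitzExtensionConstant E3)
  have hL : 0 < L := lipschitzExtensionConstant_pos E3
  refine ⟨1 / (L * C + 1) / 2, by positivity, fun y hy => ?_⟩
  set ρ : ℝ := 1 / (L * C + 1) / 2
  have hρ : 0 < ρ := by positivity
  set d : Fin 6 → E3 := fun i => y i - x i
  let pt : (Fin 6 → E3) → Fin 6 × Set.Icc (0 : ℝ) 1 → E3 := fun z q => edgePoint z q.1 q.2
  have hlip : ∀ p q, ‖pt d p - pt d q‖ ≤ C * ρ * ‖pt x p - pt x q‖ := fun p q =>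
    hbound d ρ hy p.1 q.1 p.2 p.2.2 q.2 q.2.2
  have hfac : (pt d).FactorsThrough (pt x) := by
    intro p q hpq
    have := hlip p q
    rw [hpq, sub_self, norm_zero, mul_zero, norm_le_zero_iff, sub_eq_zero] at this
    exact this
  have hφ : LipschitzOnWith (C * ρ).toNNReal (Function.extend (pt x) (pt d) 0)
      (Set.range (pt x)) := by
    refine LipschitzOnWith.of_dist_le_mul ?_
    rintro _ ⟨p, rfl⟩ _ ⟨q, rfl⟩
    rw [hfac.extend_apply, hfac.extend_apply, dist_eq_norm, dist_eq_norm,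
      Real.coe_toNNReal _ (by positivity)]
    exact hlip p q
  obtain ⟨g, hg, hgeq⟩ := hφ.extend_finite_dimension
  obtain ⟨Φ, hΦ⟩ := exists_homeomorph_id_add hg (by
    rw [← NNReal.coe_lt_coe, NNReal.coe_mul, Real.coe_toNNReal _ (by positivity), NNReal.coe_one]
    change L * (C * (1 / (L * C + 1) / 2)) < 1
    have : 0 ≤ L * C := by positivity
    rw [show L * (C * (1 / (L * C + 1) / 2)) = (L * C) / (2 * (L * C + 1)) by field_simp,
      div_lt_one (by positivity)]
    linarith)
  refine hx.map_edgePoint Φ fun i s hs => ?_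
  have h1 : g (edgePoint x i s) = edgePoint d i s := by
    rw [← hgeq ⟨(i, ⟨s, hs⟩), rfl⟩]
    exact hfac.extend_apply 0 (i, ⟨s, hs⟩)
  rw [hΦ, h1]
  simp only [edgePoint, d]
  module

/-! ### Projective transformations -/

theorem exists_linearEquiv_of_same_relations {ι V : Type*} [Fintype ι] [AddCommGroup V]
    [Module ℝ V] [FiniteDimensional ℝ V] (Z Z' : ι → V)
    (h : ∀ c : ι → ℝ, ∑ i, c i • Z i = 0 ↔ ∑ i, c i • Z' i = 0) :
    ∃ T : V ≃ₗ[ℝ] V, ∀ i, T (Z i) = Z' i := by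
  classical
  let f := Fintype.linearCombination ℝ Z
  let f' := Fintype.linearCombination ℝ Z'
  have hker : LinearMap.ker f = LinearMap.ker f' := by
    ext c
    simpa [f, f', Fintype.linearCombination_apply] using h c
  let e : LinearMap.range f ≃ₗ[ℝ] LinearMap.range f' :=
    f.quotKerEquivRange.symm ≪≫ₗ Submodule.quotEquivOfEq _ _ hker ≪≫ₗ f'.quotKerEquivRange
  have he : ∀ c, e ⟨f c, LinearMap.mem_range_self f c⟩ = ⟨f' c, LinearMap.mem_range_self f' c⟩ := by
    intro c
    have : (⟨f c, LinearMap.mem_range_self f c⟩ : LinearMap.range f) =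
        f.quotKerEquivRange (Submodule.Quotient.mk c) := rfl
    rw [this]
    simp only [e, LinearEquiv.trans_apply, LinearEquiv.symm_apply_apply]
    rfl
  obtain ⟨W, hW⟩ := (LinearMap.range f).exists_isCompl
  obtain ⟨W', hW'⟩ := (LinearMap.range f').exists_isCompl
  have hdim : Module.finrank ℝ W = Module.finrank ℝ W' := by
    have h1 := Submodule.finrank_add_eq_of_isCompl hW
    have h2 := Submodule.finrank_add_eq_of_isCompl hW'
    have h3 := e.finrank_eq
    lia
  let eW := LinearEquiv.ofFinrankEq W W' hdim
  refine ⟨(Submodule.prodEquivOfIsCompl _ _ hW).symm ≪≫ₗ (e.prodCongr eW) ≪≫ₗ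
    Submodule.prodEquivOfIsCompl _ _ hW', fun i => ?_⟩
  have hZ : f (Pi.single i 1) = Z i := by simp [f, Fintype.linearCombination_apply_single]
  have hZ' : f' (Pi.single i 1) = Z' i := by simp [f', Fintype.linearCombination_apply_single]
  rw [← hZ, ← hZ']
  have := Submodule.prodEquivOfIsCompl_symm_apply_left _ _ hW
    (⟨f (Pi.single i 1), LinearMap.mem_range_self f _⟩ : LinearMap.range f)
  simp only [LinearEquiv.trans_apply]
  rw [this]
  simp [LinearEquiv.prodCongr_apply, he]

/-- A homeomorphism from the line to the open half-line which is the identity on `[c, ∞)`. -/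
noncomputable def halfLineHomeomorph (c : ℝ) (hc : 0 < c) : ℝ ≃ₜ Set.Ioi (0 : ℝ) where
  toFun s := ⟨if c ≤ s then s else c * Real.exp (s / c - 1), by
    split_ifs with h
    · exact hc.trans_le h
    · exact mul_pos hc (Real.exp_pos _)⟩
  invFun r := if c ≤ r then r else c * (1 + Real.log (r / c))
  left_inv s := by
    dsimp only
    by_cases h : c ≤ s
    · simp [h]
    · have hs : s / c < 1 := (div_lt_one hc).2 (not_le.1 h)
      have : ¬ c ≤ c * Real.exp (s / c - 1) := by
        rw [not_le]
        exact mul_lt_of_lt_one_right hc (Real.exp_lt_one_iff.2 (by linarith))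
      simp only [if_neg h]
      rw [if_neg this, mul_div_cancel_left₀ _ hc.ne', Real.log_exp]
      field_simp
      ring
  right_inv := by
    rintro ⟨r, hr⟩
    have hr : 0 < r := hr
    ext
    dsimp only
    by_cases h : c ≤ r
    · simp [h]
    · have h1 : Real.log (r / c) < 0 :=
        Real.log_neg (by positivity) ((div_lt_one hc).2 (not_le.1 h))
      have h2 : ¬ c ≤ c * (1 + Real.log (r / c)) := by
        rw [not_le]
        exact mul_lt_of_lt_one_right hc (by linarith)
      simp only [if_neg h]
      rw [if_neg h2, mul_div_cancel_left₀ _ hc.ne', add_sub_cancel_left,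
        Real.exp_log (by positivity)]
      field_simp
  continuous_toFun := by
    refine Continuous.subtype_mk (Continuous.if_le continuous_id (by fun_prop) continuous_const
      continuous_id ?_) _
    rintro s rfl
    simp [hc.ne']
  continuous_invFun := by
    refine Continuous.if_le continuous_subtype_val ?_ continuous_const continuous_subtype_val ?_
    · refine continuous_const.mul (continuous_const.add (Continuous.log (by fun_prop) ?_))
      rintro ⟨r, hr⟩
      have hr : 0 < r := hr
      positivity
    · rintro ⟨r, hr⟩ h
      simp only at h
      simp [← h, hc.ne']

theorem halfLineHomeomorph_of_le {c : ℝ} (hc : 0 < c) {s : ℝ} (hs : c ≤ s) :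
    (halfLineHomeomorph c hc s : ℝ) = s := if_pos hs

/-- Space is homeomorphic to an open half-space by a map which fixes a smaller half-space. -/
theorem exists_homeomorph_halfSpace {E : Type*} [NormedAddCommGroup E] [NormedSpace ℝ E]
    {m : E → ℝ} {a : ℝ} {f : E →L[ℝ] ℝ} (hm : ∀ y, m y = a + f y) {c : ℝ} (hc : 0 < c)
    (hne : ∃ y, 0 < m y) :
    ∃ e : E ≃ₜ {y : E // 0 < m y}, ∀ y, c ≤ m y → (e y : E) = y := by
  have hcont : Continuous m := by
    rw [funext hm]
    fun_prop
  by_cases hf : f = 0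
  · obtain ⟨y₀, hy₀⟩ := hne
    have h : ∀ y : E, 0 < m y := fun y => by simpa [hm, hf] using hy₀
    exact ⟨(Homeomorph.Set.univ E).symm.trans
      (Homeomorph.setCongr (s := Set.univ) (t := {y : E | 0 < m y})
        (Set.eq_univ_of_forall h).symm), fun y _ => rfl⟩
  · obtain ⟨z, hz⟩ : ∃ z, f z ≠ 0 := by
      by_contra! h
      exact hf (ContinuousLinearMap.ext h)
    obtain ⟨e, he⟩ : ∃ e, f e = 1 := ⟨(f z)⁻¹ • z, by simp [hz]⟩
    let g := halfLineHomeomorph c hc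
    have hval : ∀ (y : E) (r : ℝ), m (y + (r - m y) • e) = r := by
      intro y r
      simp only [hm, map_add, map_smul, he, smul_eq_mul]
      ring
    refine ⟨{
      toFun := fun y => ⟨y + ((g (m y) : ℝ) - m y) • e, by
        rw [hval]; exact (g (m y)).2⟩
      invFun := fun y => y + (g.symm ⟨m y, y.2⟩ - m y) • e
      left_inv := fun y => by
        simp only [hval, Subtype.coe_eta, Homeomorph.symm_apply_apply]
        module
      right_inv := fun y => by
        ext1
        simp only [hval, Homeomorph.apply_symm_apply]
        module
      continuous_toFun := by fun_prop
      continuous_invFun := by fun_prop }, fun y hy => ?_⟩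
    change y + ((g (m y) : ℝ) - m y) • e = y
    rw [halfLineHomeomorph_of_le hc hy]
    simp

section Projective

variable {E : Type*} [NormedAddCommGroup E] [NormedSpace ℝ E]

/-- The denominator of the projective transformation of `E` induced by `T`. -/
noncomputable def projWeight (T : (ℝ × E) ≃L[ℝ] (ℝ × E)) (y : E) : ℝ := (T (1, y)).1

/-- The projective transformation of `E` induced by `T`. -/
noncomputable def projMap (T : (ℝ × E) ≃L[ℝ] (ℝ × E)) (y : E) : E := (projWeight T y)⁻¹ • (T (1, y)).2

theorem projWeight_eq (T : (ℝ × E) ≃L[ℝ] (ℝ × E)) (y : E) :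
    projWeight T y = (T (1, 0)).1 +
      ((ContinuousLinearMap.fst ℝ ℝ E).comp
        ((T : (ℝ × E) →L[ℝ] (ℝ × E)).comp (ContinuousLinearMap.inr ℝ ℝ E))) y := by
  have : ((1 : ℝ), y) = (1, 0) + (0, y) := by simp
  simp only [projWeight]
  rw [this, map_add]
  simp

theorem continuous_projWeight (T : (ℝ × E) ≃L[ℝ] (ℝ × E)) : Continuous (projWeight T) := by
  unfold projWeight
  fun_prop

theorem projWeight_smul_projMap {T : (ℝ × E) ≃L[ℝ] (ℝ × E)} {y : E} (h : projWeight T y ≠ 0) :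
    projWeight T y • ((1 : ℝ), projMap T y) = T (1, y) := by
  ext1
  · simp [projWeight]
  · simp [projMap, smul_smul, h]

theorem projWeight_projMap_of_smul {T : (ℝ × E) ≃L[ℝ] (ℝ × E)} {y z : E} {w : ℝ} (hw : w ≠ 0)
    (h : T (1, y) = w • ((1 : ℝ), z)) : projWeight T y = w ∧ projMap T y = z := by
  have h1 : projWeight T y = w := by simp [projWeight, h]
  exact ⟨h1, by simp [projMap, h1, h, smul_smul, hw]⟩

theorem symm_apply_projMap {T : (ℝ × E) ≃L[ℝ] (ℝ × E)} {y : E} (h : projWeight T y ≠ 0) :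
    T.symm (1, projMap T y) = (projWeight T y)⁻¹ • ((1 : ℝ), y) := by
  rw [ContinuousLinearEquiv.symm_apply_eq, map_smul, ← projWeight_smul_projMap h, smul_smul,
    inv_mul_cancel₀ h, one_smul]

theorem projWeight_symm_projMap {T : (ℝ × E) ≃L[ℝ] (ℝ × E)} {y : E} (h : projWeight T y ≠ 0) :
    projWeight T.symm (projMap T y) = (projWeight T y)⁻¹ :=
  (projWeight_projMap_of_smul (inv_ne_zero h) (symm_apply_projMap h)).1

theorem projMap_symm_projMap {T : (ℝ × E) ≃L[ℝ] (ℝ × E)} {y : E} (h : projWeight T y ≠ 0) :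
    projMap T.symm (projMap T y) = y :=
  (projWeight_projMap_of_smul (inv_ne_zero h) (symm_apply_projMap h)).2

/-- A projective transformation is a homeomorphism between two open half-spaces. -/
noncomputable def projHomeomorph (T : (ℝ × E) ≃L[ℝ] (ℝ × E)) :
    {y : E // 0 < projWeight T y} ≃ₜ {z : E // 0 < projWeight T.symm z} where
  toFun y := ⟨projMap T y, by rw [projWeight_symm_projMap y.2.ne']; exact inv_pos.2 y.2⟩
  invFun z := ⟨projMap T.symm z, by
    have := projWeight_symm_projMap z.2.ne'
    rw [T.symm_symm] at this
    rw [this]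
    exact inv_pos.2 z.2⟩
  left_inv y := Subtype.ext (projMap_symm_projMap y.2.ne')
  right_inv z := Subtype.ext (by
    have := projMap_symm_projMap z.2.ne'
    rwa [T.symm_symm] at this)
  continuous_toFun := by
    refine Continuous.subtype_mk (Continuous.smul (Continuous.inv₀
      ((continuous_projWeight T).comp continuous_subtype_val) fun y => y.2.ne') ?_) _
    fun_prop
  continuous_invFun := by
    refine Continuous.subtype_mk (Continuous.smul (Continuous.inv₀
      ((continuous_projWeight T.symm).comp continuous_subtype_val) fun y => y.2.ne') ?_) _
    fun_prop

theorem exists_homeomorph_projWeight_pos (T : (ℝ × E) ≃L[ℝ] (ℝ × E)) {c : ℝ} (hc : 0 < c)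
    (hne : ∃ y, 0 < projWeight T y) :
    ∃ e : E ≃ₜ {y : E // 0 < projWeight T y}, ∀ y, c ≤ projWeight T y → (e y : E) = y :=
  exists_homeomorph_halfSpace (projWeight_eq T) hc hne

/-- On a compact set with positive denominators, a projective transformation agrees with a
homeomorphism of the whole space. -/
theorem exists_homeomorph_eq_projMap (T : (ℝ × E) ≃L[ℝ] (ℝ × E)) {K : Set E} (hK : IsCompact K)
    (hne : K.Nonempty) (hpos : ∀ y ∈ K, 0 < projWeight T y) :
    ∃ Φ : E ≃ₜ E, ∀ y ∈ K, Φ y = projMap T y := by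
  obtain ⟨y₁, hy₁, hmin⟩ := hK.exists_isMinOn hne (continuous_projWeight T).continuousOn
  obtain ⟨y₂, hy₂, hmax⟩ := hK.exists_isMaxOn hne (continuous_projWeight T).continuousOn
  obtain ⟨e, he⟩ := exists_homeomorph_projWeight_pos T (hpos y₁ hy₁) ⟨y₁, hpos y₁ hy₁⟩
  obtain ⟨e', he'⟩ := exists_homeomorph_projWeight_pos T.symm (inv_pos.2 (hpos y₂ hy₂))
    ⟨projMap T y₂, by
      rw [projWeight_symm_projMap (hpos y₂ hy₂).ne']; exact inv_pos.2 (hpos y₂ hy₂)⟩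
  refine ⟨e.trans ((projHomeomorph T).trans e'.symm), fun y hy => ?_⟩
  simp only [Homeomorph.trans_apply]
  rw [Homeomorph.symm_apply_eq]
  have h1 : e y = ⟨y, hpos y hy⟩ := Subtype.ext (he y (isMinOn_iff.1 hmin y hy))
  rw [h1]
  ext1
  rw [he' (projMap T y)]
  · rfl
  · rw [projWeight_symm_projMap (hpos y hy).ne']
    exact inv_anti₀ (hpos y hy) (isMaxOn_iff.1 hmax y hy)

end Projective

theorem projMap_edgePoint_mem {T : (ℝ × E3) ≃L[ℝ] (ℝ × E3)} {x y : Fin 6 → E3} {w : Fin 6 → ℝ}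
    (hw : ∀ i, 0 < w i) (hT : ∀ i, T (1, y i) = w i • ((1 : ℝ), x i)) (i : Fin 6) {z : E3}
    (hz : z ∈ (hexagon y).edgeSet ℝ i) :
    0 < projWeight T z ∧ projMap T z ∈ (hexagon x).edgeSet ℝ i := by
  rw [edgeSet_hexagon] at hz ⊢
  obtain ⟨s, hs, rfl⟩ := hz
  have hs' : 0 ≤ 1 - s := by linarith [hs.2]
  obtain ⟨m, hm⟩ : ∃ m, m = (1 - s) * w i + s * w (i + 1) := ⟨_, rfl⟩
  have hmpos : 0 < m := by
    rcases hs.1.eq_or_lt with h | h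
    · rw [hm, ← h]; simpa using hw i
    · have := mul_nonneg hs' (hw i).le
      have := mul_pos h (hw (i + 1))
      linarith
  have key : T (1, edgePoint y i s) = m • ((1 : ℝ), edgePoint x i (s * w (i + 1) / m)) := by
    have h1 : ((1 : ℝ), edgePoint y i s) = (1 - s) • ((1 : ℝ), y i) + s • ((1 : ℝ), y (i + 1)) := by
      ext1 <;> simp [edgePoint]
    rw [h1, map_add, map_smul, map_smul, hT, hT]
    have h2 : m - s * w (i + 1) = (1 - s) * w i := by rw [hm]; ring
    ext1
    · simp [hm]
    · simp only [edgePoint, Prod.smul_mk, Prod.mk_add_mk, smul_add, smul_smul, mul_sub, mul_one,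
        mul_div_cancel₀ _ hmpos.ne', h2]
  obtain ⟨h1, h2⟩ := projWeight_projMap_of_smul hmpos.ne' key
  refine ⟨h1 ▸ hmpos, s * w (i + 1) / m, ⟨?_, ?_⟩, h2.symm⟩
  · have := mul_nonneg hs.1 (hw (i + 1)).le
    positivity
  · rw [div_le_one hmpos, hm]
    linarith [mul_nonneg hs' (hw i).le]

/-- Projective transformations with positive denominators preserve trefoil hexagons. -/
theorem IsTrefoilHexagon.of_projective {x y : Fin 6 → E3} (hx : IsTrefoilHexagon x)
    (T : (ℝ × E3) ≃L[ℝ] (ℝ × E3)) {w : Fin 6 → ℝ} (hw : ∀ i, 0 < w i)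
    (hT : ∀ i, T (1, y i) = w i • ((1 : ℝ), x i)) : IsTrefoilHexagon y := by
  have hT' : ∀ i, T.symm (1, x i) = (w i)⁻¹ • ((1 : ℝ), y i) := fun i => by
    rw [ContinuousLinearEquiv.symm_apply_eq, map_smul, hT, smul_smul, inv_mul_cancel₀ (hw i).ne',
      one_smul]
  have hw' : ∀ i, 0 < (w i)⁻¹ := fun i => inv_pos.2 (hw i)
  have hvert : ∀ i, y i ∈ (hexagon y).edgeSet ℝ i := fun i => by
    rw [edgeSet_hexagon]
    exact ⟨0, by simp, by simp [edgePoint]⟩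
  have hsub : ∀ i, (hexagon y).edgeSet ℝ i ⊆ (hexagon y).boundary ℝ := fun i =>
    Set.subset_iUnion (fun i => (hexagon y).edgeSet ℝ i) i
  have hcompact : IsCompact ((hexagon y).boundary ℝ) := by
    refine isCompact_iUnion fun i => ?_
    rw [edgeSet_hexagon]
    exact isCompact_Icc.image (by unfold edgePoint; fun_prop)
  obtain ⟨Φ, hΦ⟩ := exists_homeomorph_eq_projMap T hcompact ⟨y 0, hsub 0 (hvert 0)⟩ (by
    intro z hz
    obtain ⟨i, hi⟩ := Set.mem_iUnion.1 hz
    exact (projMap_edgePoint_mem hw hT i hi).1)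
  refine hx.of_homeomorph Φ (fun i => ?_) (fun i => ?_)
  · rw [hΦ _ (hsub i (hvert i))]
    exact (projWeight_projMap_of_smul (hw i).ne' (hT i)).2
  · refine Set.Subset.antisymm ?_ fun z hz => ?_
    · rintro _ ⟨z, hz, rfl⟩
      rw [hΦ _ (hsub i hz)]
      exact (projMap_edgePoint_mem hw hT i hz).2
    · obtain ⟨h1, h2⟩ := projMap_edgePoint_mem hw' hT' i hz
      refine ⟨projMap T.symm z, h2, ?_⟩
      rw [hΦ _ (hsub i h2)]
      have := projMap_symm_projMap h1.ne'
      rwa [T.symm_symm] at this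

/-- Two hexagons whose homogeneous coordinates satisfy the same linear relations, up to positive
weights, are trefoils simultaneously. -/
theorem IsTrefoilHexagon.of_same_relations {x y : Fin 6 → E3} (hx : IsTrefoilHexagon x)
    {w : Fin 6 → ℝ} (hw : ∀ i, 0 < w i)
    (h : ∀ c : Fin 6 → ℝ, (∑ i, c i = 0 ∧ ∑ i, c i • y i = 0) ↔
      (∑ i, c i * w i = 0 ∧ ∑ i, (c i * w i) • x i = 0)) : IsTrefoilHexagon y := by
  obtain ⟨T, hT⟩ := exists_linearEquiv_of_same_relations
    (fun i => ((1 : ℝ), y i)) (fun i => w i • ((1 : ℝ), x i)) (by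
      intro c
      simp only [Prod.ext_iff, Prod.fst_sum, Prod.snd_sum, Prod.smul_fst, Prod.smul_snd,
        Prod.fst_zero, Prod.snd_zero, smul_eq_mul, mul_one, smul_smul]
      exact h c)
  exact hx.of_projective T.toContinuousLinearEquiv hw hT

/-! ### Stereographic projection -/

theorem exists_toS3_eq : ∃ A : E3 →ₗ[ℝ] E4, Function.Injective A ∧
    (∀ p, inner ℝ (northPole : E4) (A p) = 0) ∧
    ∀ p, (‖p‖ ^ 2 + 4) • (toS3 p : E4) =
      (4 : ℝ) • A p + (‖p‖ ^ 2 - 4) • (northPole : E4) := by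
  let U := (OrthonormalBasis.fromOrthogonalSpanSingleton (𝕜 := ℝ) 3
    (ne_zero_of_mem_unit_sphere northPole)).repr
  refine ⟨(Submodule.subtype _).comp U.symm.toLinearEquiv.toLinearMap, ?_, fun p => ?_,
    fun p => ?_⟩
  · exact Subtype.val_injective.comp U.symm.injective
  · exact Submodule.mem_orthogonal_singleton_iff_inner_right.1 (U.symm p).2
  · have h := stereographic'_symm_apply (n := 3) northPole p
    have hn : ‖(U.symm p : E4)‖ = ‖p‖ := U.symm.norm_map p
    have hpos : ‖p‖ ^ 2 + 4 ≠ 0 := by positivity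
    change (‖p‖ ^ 2 + 4) • ((stereographic' 3 northPole).symm p : E4) = _
    rw [h]
    simp only [U] at hn
    simp only [hn, smul_add, smul_smul, mul_inv_cancel_left₀ hpos]
    rfl

theorem exists_stereographic_eq (v : S3) : ∃ R : E4 →ₗ[ℝ] E3,
    (∀ x, ‖x‖ ^ 2 = inner ℝ (v : E4) x ^ 2 + ‖R x‖ ^ 2) ∧
    ∀ x : S3, stereographic' 3 v x = (2 / (1 - inner ℝ (v : E4) x)) • R x := by
  let U := (OrthonormalBasis.fromOrthogonalSpanSingleton (𝕜 := ℝ) 3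
    (ne_zero_of_mem_unit_sphere v)).repr
  refine ⟨U.toLinearEquiv.toLinearMap.comp
    ((Submodule.span ℝ {(v : E4)})ᗮ.orthogonalProjectionOnto : E4 →ₗ[ℝ] _),
    fun x => ?_, fun x => ?_⟩
  · have hv : ‖(v : E4)‖ = 1 := norm_eq_of_mem_sphere v
    have h := Submodule.norm_sq_eq_add_norm_sq_projection x (Submodule.span ℝ {(v : E4)})
    rw [h]
    congr 1
    · rw [Submodule.coe_norm, Submodule.coe_orthogonalProjectionOnto_apply,
        Submodule.starProjection_unit_singleton ℝ hv, norm_smul, hv, mul_one, Real.norm_eq_abs, sq_abs]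
    · change _ = ‖U _‖ ^ 2
      rw [U.norm_map]
      rfl
  · change U (stereographic (norm_eq_of_mem_sphere v) x) = _
    rw [stereographic_apply, map_smul]
    rfl

/-- The linear relations between the points `(1, p, ‖p‖²)` are carried by inverse stereographic
projection to the affine relations on the sphere. -/
theorem relations_toS3_iff (p : Fin 6 → E3) (c : Fin 6 → ℝ) :
    (∑ i, c i * (‖p i‖ ^ 2 + 4) = 0 ∧ ∑ i, (c i * (‖p i‖ ^ 2 + 4)) • (toS3 (p i) : E4) = 0) ↔
      (∑ i, c i = 0 ∧ ∑ i, c i • p i = 0 ∧ ∑ i, c i * ‖p i‖ ^ 2 = 0) := by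
  obtain ⟨A, hA, hperp, htoS3⟩ := exists_toS3_eq
  have h1 : ∑ i, c i * (‖p i‖ ^ 2 + 4) = ∑ i, c i * ‖p i‖ ^ 2 + 4 * ∑ i, c i := by
    rw [Finset.mul_sum, ← Finset.sum_add_distrib]
    exact Finset.sum_congr rfl fun i _ => by ring
  have h2 : ∑ i, (c i * (‖p i‖ ^ 2 + 4)) • (toS3 (p i) : E4) =
      (4 : ℝ) • A (∑ i, c i • p i) +
        (∑ i, c i * ‖p i‖ ^ 2 - 4 * ∑ i, c i) • (northPole : E4) := by
    rw [map_sum, Finset.smul_sum, Finset.mul_sum, ← Finset.sum_sub_distrib, Finset.sum_smul,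
      ← Finset.sum_add_distrib]
    refine Finset.sum_congr rfl fun i _ => ?_
    rw [mul_smul, htoS3, map_smul]
    module
  rw [h1, h2]
  constructor
  · rintro ⟨h3, h4⟩
    have h5 : ∑ i, c i * ‖p i‖ ^ 2 - 4 * ∑ i, c i = 0 := by
      have hn : ‖(northPole : E4)‖ = 1 := norm_eq_of_mem_sphere northPole
      have := congrArg (inner ℝ (northPole : E4)) h4
      simpa [-map_sum, inner_add_right, inner_smul_right, hperp, hn] using this
    rw [h5, zero_smul, add_zero, smul_eq_zero_iff_right (by norm_num)] at h4
    refine ⟨by linarith, ?_, by linarith⟩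
    exact hA (h4.trans (map_zero A).symm)
  · rintro ⟨h3, h4, h5⟩
    simp [h3, h4, h5]

theorem inner_lt_one_of_ne {v x : S3} (h : x ≠ v) : inner ℝ (v : E4) (x : E4) < 1 :=
  (inner_lt_one_iff_real_of_norm_eq_one (norm_eq_of_mem_sphere v) (norm_eq_of_mem_sphere x)).2
    fun h' => h (Subtype.ext h'.symm)

/-- Stereographic projection of points of `S³` to cospherical points of `ℝ³` preserves affine
relations up to positive weights. -/
theorem relations_stereographic_iff {v : S3} {X : Fin 6 → S3} (hne : ∀ i, X i ≠ v)
    (hsph : EuclideanGeometry.Cospherical (Set.range fun i => stereographic' 3 v (X i)))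
    (c : Fin 6 → ℝ) :
    (∑ i, c i = 0 ∧ ∑ i, c i • (X i : E4) = 0) ↔
      (∑ i, c i * (1 - inner ℝ (v : E4) (X i)) = 0 ∧
        ∑ i, (c i * (1 - inner ℝ (v : E4) (X i))) • stereographic' 3 v (X i) = 0) := by
  obtain ⟨R, hR, hster⟩ := exists_stereographic_eq v
  have hpos : ∀ i, 1 - inner ℝ (v : E4) (X i : E4) ≠ 0 := fun i =>
    (sub_pos.2 (inner_lt_one_of_ne (hne i))).ne'
  have h1 : ∑ i, (c i * (1 - inner ℝ (v : E4) (X i))) • stereographic' 3 v (X i) =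
      (2 : ℝ) • R (∑ i, c i • (X i : E4)) := by
    rw [map_sum, Finset.smul_sum]
    refine Finset.sum_congr rfl fun i _ => ?_
    rw [hster, map_smul, smul_smul, smul_smul]
    congr 1
    field_simp [hpos i]
  have h2 : ∑ i, c i * inner ℝ (v : E4) (X i : E4) = inner ℝ (v : E4) (∑ i, c i • (X i : E4)) := by
    simp [inner_sum, inner_smul_right]
  have h3 : ∑ i, c i * (1 - inner ℝ (v : E4) (X i : E4)) =
      ∑ i, c i - inner ℝ (v : E4) (∑ i, c i • (X i : E4)) := by
    rw [← h2, ← Finset.sum_sub_distrib]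
    exact Finset.sum_congr rfl fun i _ => by ring
  constructor
  · rintro ⟨h4, h5⟩
    rw [h1, h3, h4, h5]
    simp
  · rintro ⟨h4, h5⟩
    have h6 : ∑ i, c i * (1 - inner ℝ (v : E4) (X i : E4)) * ‖stereographic' 3 v (X i)‖ ^ 2 =
        4 * (∑ i, c i + inner ℝ (v : E4) (∑ i, c i • (X i : E4))) := by
      rw [← h2, ← Finset.sum_add_distrib, Finset.mul_sum]
      refine Finset.sum_congr rfl fun i _ => ?_
      have hn : ‖(X i : E4)‖ = 1 := norm_eq_of_mem_sphere (X i)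
      have := hR (X i)
      rw [hn] at this
      have h7 : ‖R (X i)‖ ^ 2 =
          (1 - inner ℝ (v : E4) (X i : E4)) * (1 + inner ℝ (v : E4) (X i : E4)) := by linarith
      rw [hster, norm_smul, mul_pow, h7, Real.norm_eq_abs, sq_abs]
      field_simp [hpos i]
      ring
    obtain ⟨z, r, hzr⟩ := hsph
    have h8 : ∑ i, c i * (1 - inner ℝ (v : E4) (X i : E4)) * ‖stereographic' 3 v (X i)‖ ^ 2 =
        (r ^ 2 - ‖z‖ ^ 2) * ∑ i, c i * (1 - inner ℝ (v : E4) (X i : E4)) +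
        2 * inner ℝ z (∑ i, (c i * (1 - inner ℝ (v : E4) (X i))) • stereographic' 3 v (X i)) := by
      rw [inner_sum, Finset.mul_sum, Finset.mul_sum, ← Finset.sum_add_distrib]
      refine Finset.sum_congr rfl fun i _ => ?_
      have := hzr _ ⟨i, rfl⟩
      rw [dist_eq_norm] at this
      have h9 := norm_sub_sq_real (stereographic' 3 v (X i)) z
      simp only at this
      rw [this, real_inner_comm] at h9
      rw [inner_smul_right]
      linear_combination (c i * (1 - inner ℝ (v : E4) (X i : E4))) * (-h9)
    rw [h4, h5, h6, inner_zero_right] at h8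
    rw [h3] at h4
    rw [h1, smul_eq_zero_iff_right (by norm_num)] at h5
    have h10 : inner ℝ (v : E4) (∑ i, c i • (X i : E4)) = 0 := by linarith
    refine ⟨by linarith, ?_⟩
    have := hR (∑ i, c i • (X i : E4))
    rw [h10, h5, norm_zero] at this
    simpa using this

/-- Six coplanar points which form a stereographic trefoil become a trefoil in `ℝ³` when each is
lifted from the plane by a fixed multiple of its power with respect to a sphere. -/
theorem IsSphericalTrefoil.lift {v : S3} {p : Fin 6 → E3} (hne : ∀ i, toS3 (p i) ≠ v)
    (hX : IsSphericalTrefoil fun i => stereographic' 3 v (toS3 (p i)))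
    {N : E3} (hN : N ≠ 0) {o : ℝ} (hp : ∀ i, inner ℝ N (p i) = o) {κ : ℝ} (hκ : κ ≠ 0)
    (a b : E3) : IsTrefoilHexagon fun i => p i + (κ * inner ℝ (p i - a) (p i - b)) • N := by
  refine hX.2.of_same_relations
    (w := fun i => (‖p i‖ ^ 2 + 4) * (1 - inner ℝ (v : E4) (toS3 (p i) : E4)))
    (fun i => mul_pos (by positivity) (sub_pos.2 (inner_lt_one_of_ne (hne i)))) fun c => ?_
  have hrel := (relations_toS3_iff p c).symm.trans
    (relations_stereographic_iff hne hX.1 fun i => c i * (‖p i‖ ^ 2 + 4))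
  simp only [← mul_assoc]
  rw [← hrel]
  refine and_congr_right fun h0 => ?_
  have hlift : ∑ i, c i • (p i + (κ * inner ℝ (p i - a) (p i - b)) • N) =
      ∑ i, c i • p i + (κ * ∑ i, c i * inner ℝ (p i - a) (p i - b)) • N := by
    rw [Finset.mul_sum, Finset.sum_smul, ← Finset.sum_add_distrib]
    exact Finset.sum_congr rfl fun i _ => by module
  have hpow : ∑ i, c i * inner ℝ (p i - a) (p i - b) =
      ∑ i, c i * ‖p i‖ ^ 2 - inner ℝ (a + b) (∑ i, c i • p i) + inner ℝ a b * ∑ i, c i := by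
    rw [inner_sum, Finset.mul_sum, ← Finset.sum_sub_distrib, ← Finset.sum_add_distrib]
    refine Finset.sum_congr rfl fun i _ => ?_
    rw [inner_sub_left, inner_sub_right, inner_sub_right, real_inner_self_eq_norm_sq,
      inner_smul_right, inner_add_left, real_inner_comm b (p i)]
    ring
  have hN' : inner ℝ N (∑ i, c i • p i) = 0 := by
    simp only [inner_sum, inner_smul_right, hp, ← Finset.sum_mul, h0, zero_mul]
  rw [hlift]
  constructor
  · intro h
    have h1 := congrArg (inner ℝ N) h
    rw [inner_add_right, hN', inner_smul_right, inner_zero_right, zero_add,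
      real_inner_self_eq_norm_sq] at h1
    have hN2 : ‖N‖ ^ 2 ≠ 0 := by positivity
    have h2 : ∑ i, c i * inner ℝ (p i - a) (p i - b) = 0 := by
      simpa [hκ, hN2, hN] using h1
    rw [h2, mul_zero, zero_smul, add_zero] at h
    rw [hpow, h, h0] at h2
    exact ⟨h, by simpa using h2⟩
  · rintro ⟨h1, h2⟩
    rw [hpow, h1, h2, h0]
    simp

/-! ### Perturbation along the curve -/

/-- Stretching space in the direction normal to a plane. -/
noncomputable def normalStretch (N : E3) (hN : N ≠ 0) (o δ : ℝ) (hδ : δ ≠ 0) : E3 ≃ₜ E3 where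
  toFun y := y + ((δ - 1) * ((inner ℝ N y - o) / ‖N‖ ^ 2)) • N
  invFun y := y + ((δ⁻¹ - 1) * ((inner ℝ N y - o) / ‖N‖ ^ 2)) • N
  left_inv y := by
    have hN2 : ‖N‖ ^ 2 ≠ 0 := by positivity
    dsimp only
    rw [inner_add_right, inner_smul_right, real_inner_self_eq_norm_sq, add_assoc, ← add_smul]
    convert add_zero y
    rw [smul_eq_zero_iff_left hN]
    field_simp
    ring
  right_inv y := by
    have hN2 : ‖N‖ ^ 2 ≠ 0 := by positivity
    dsimp only
    rw [inner_add_right, inner_smul_right, real_inner_self_eq_norm_sq, add_assoc, ← add_smul]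
    convert add_zero y
    rw [smul_eq_zero_iff_left hN]
    field_simp
    ring
  continuous_toFun := by fun_prop
  continuous_invFun := by fun_prop

theorem normalStretch_edgePoint {N : E3} (hN : N ≠ 0) (o : ℝ) {δ : ℝ} (hδ : δ ≠ 0)
    (y : Fin 6 → E3) (i : Fin 6) (s : ℝ) :
    normalStretch N hN o δ hδ (edgePoint y i s) =
      edgePoint (fun k => normalStretch N hN o δ hδ (y k)) i s := by
  simp only [normalStretch, Homeomorph.homeomorph_mk_coe, Equiv.coe_fn_mk, edgePoint,
    inner_add_right, inner_smul_right]
  module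

/-- A point lifted to height `δ h` near a point of the plane is close, after rescaling the
heights by `δ`, to the lift of the latter by `h`. -/
theorem norm_sub_normalStretch_le {N : E3} (hN : N ≠ 0) {o δ h : ℝ} (hδ : δ ≠ 0) {p y : E3}
    (hp : inner ℝ N p = o) (hy : inner ℝ N y - o = δ * h) :
    ‖normalStretch N hN o δ⁻¹ (inv_ne_zero hδ) y - (p + (h / ‖N‖ ^ 2) • N)‖ ≤ 2 * ‖y - p‖ := by
  have hN1 : 0 < ‖N‖ := norm_pos_iff.2 hN
  have h1 : normalStretch N hN o δ⁻¹ (inv_ne_zero hδ) y - (p + (h / ‖N‖ ^ 2) • N) =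
      (y - p) - (inner ℝ N (y - p) / ‖N‖ ^ 2) • N := by
    have h2 : inner ℝ N (y - p) = δ * h := by rw [inner_sub_right, hp, hy]
    simp only [normalStretch, Homeomorph.homeomorph_mk_coe, Equiv.coe_fn_mk, h2, hy]
    have h3 : (δ⁻¹ - 1) * (δ * h / ‖N‖ ^ 2) = h / ‖N‖ ^ 2 - δ * h / ‖N‖ ^ 2 := by
      field_simp
    rw [h3]
    module
  rw [h1]
  refine (norm_sub_le _ _).trans ?_
  have h4 : ‖(inner ℝ N (y - p) / ‖N‖ ^ 2) • N‖ ≤ ‖y - p‖ := by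
    rw [norm_smul, Real.norm_eq_abs, abs_div, abs_of_pos (by positivity : 0 < ‖N‖ ^ 2),
      div_mul_eq_mul_div, div_le_iff₀ (by positivity)]
    nlinarith [abs_real_inner_le_norm N (y - p)]
  linarith

/-- By the intermediate value theorem, a continuous function vanishing at `t` attains near `t` all
small multiples of `h`, if it attains a value of the same sign as `h`. -/
theorem exists_eq_mul_of_sign {η : ℝ → ℝ} (hη : Continuous η) {t h ρ : ℝ} (ht : η t = 0)
    (hρ : 0 < ρ) (hs : h = 0 ∨ ∃ s, |s - t| < ρ ∧ 0 < η s * h) :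
    ∃ δ₀ > 0, ∀ δ, 0 < δ → δ ≤ δ₀ → ∃ u, |u - t| < ρ ∧ η u = δ * h := by
  rcases eq_or_ne h 0 with rfl | h0
  · exact ⟨1, one_pos, fun δ _ _ => ⟨t, by simpa using hρ, by simpa using ht⟩⟩
  · obtain ⟨s, hst, hpos⟩ := hs.resolve_left h0
    have hδ₀ : 0 < η s / h := by
      rw [show η s / h = η s * h / h ^ 2 by field_simp]
      positivity
    refine ⟨η s / h, hδ₀, fun δ hδ hδ' => ?_⟩
    have hmem : δ * h ∈ Set.uIcc (η t) (η s) := by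
      have hηs : η s = η s / h * h := by field_simp
      rw [ht, Set.mem_uIcc]
      rcases lt_or_gt_of_ne h0 with hneg | hpos'
      · right
        constructor
        · rw [hηs]; nlinarith
        · nlinarith
      · left
        constructor
        · positivity
        · rw [hηs]; gcongr
    obtain ⟨u, hu, hu'⟩ := intermediate_value_uIcc hη.continuousOn hmem
    refine ⟨u, lt_of_le_of_lt ?_ hst, hu'⟩
    exact Set.abs_sub_left_of_mem_uIcc hu

/-- An analytic curve not contained in a plane leaves the plane in every interval. -/
theorem IsAnalyticKnot.exists_notMem_carrier {γ : ℝ → E3} (hγ : IsAnalyticKnot γ)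
    {P : OrientedPlane} (hγP : ∃ s, γ s ∉ P.carrier) (t : ℝ) {ρ : ℝ} (hρ : 0 < ρ) :
    ∃ s, |s - t| < ρ ∧ inner ℝ P.normal (γ s) - P.offset ≠ 0 := by
  by_contra! h
  obtain ⟨s, hs⟩ := hγP
  have han : AnalyticOnNhd ℝ (fun s => inner ℝ P.normal (γ s)) Set.univ := fun s hs =>
    ((innerSL ℝ P.normal).analyticAt _).comp (hγ.analytic s hs)
  have heq := han.eqOn_of_preconnected_of_eventuallyEq
    (analyticOnNhd_const (v := P.offset)) isPreconnected_univ (Set.mem_univ t) (by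
      filter_upwards [Metric.ball_mem_nhds t hρ] with s hs
      exact sub_eq_zero.1 (h s hs))
  exact hs (heq (Set.mem_univ s))

section OneSided

variable {γ : ℝ → E3} {P : OrientedPlane} {t : ℝ}

theorem exists_top_of_not_negativeOneSided (ht : γ t ∈ P.carrier)
    (hnd : ∀ ρ > 0, ∃ s, |s - t| < ρ ∧ inner ℝ P.normal (γ s) - P.offset ≠ 0)
    (h : ¬ P.NegativeOneSided γ t) {ρ : ℝ} (hρ : 0 < ρ) :
    ∃ s, |s - t| < ρ ∧ 0 < inner ℝ P.normal (γ s) - P.offset := by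
  by_contra! hle
  obtain ⟨s, hs, hs0⟩ := hnd ρ hρ
  have habs : ∀ {s}, s ∈ Set.Ioo (t - ρ) (t + ρ) ↔ |s - t| < ρ := by
    intro s
    rw [abs_sub_lt_iff, Set.mem_Ioo]
    constructor <;> rintro ⟨h1, h2⟩ <;> constructor <;> linarith
  refine h ⟨ht, t - ρ, t + ρ, by linarith, by linarith, ⟨s, habs.2 hs, ?_⟩, fun r hr hr' => ?_⟩
  · exact sub_neg.1 (lt_of_le_of_ne (hle s hs) hs0)
  · exact (hle r (habs.1 hr)).not_gt (sub_pos.2 hr')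

theorem exists_bottom_of_not_positiveOneSided (ht : γ t ∈ P.carrier)
    (hnd : ∀ ρ > 0, ∃ s, |s - t| < ρ ∧ inner ℝ P.normal (γ s) - P.offset ≠ 0)
    (h : ¬ P.PositiveOneSided γ t) {ρ : ℝ} (hρ : 0 < ρ) :
    ∃ s, |s - t| < ρ ∧ inner ℝ P.normal (γ s) - P.offset < 0 := by
  by_contra! hle
  obtain ⟨s, hs, hs0⟩ := hnd ρ hρ
  have habs : ∀ {s}, s ∈ Set.Ioo (t - ρ) (t + ρ) ↔ |s - t| < ρ := by
    intro s
    rw [abs_sub_lt_iff, Set.mem_Ioo]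
    constructor <;> rintro ⟨h1, h2⟩ <;> constructor <;> linarith
  refine h ⟨ht, t - ρ, t + ρ, by linarith, by linarith, ⟨s, habs.2 hs, ?_⟩, fun r hr hr' => ?_⟩
  · exact sub_pos.1 (lt_of_le_of_ne (hle s hs) hs0.symm)
  · exact (hle r (habs.1 hr)).not_gt (sub_neg.2 hr')

/-- At least one side of the plane is met by the curve arbitrarily close to `t`. -/
theorem exists_sign_approached
    (hnd : ∀ ρ > 0, ∃ s, |s - t| < ρ ∧ inner ℝ P.normal (γ s) - P.offset ≠ 0) :
    ∃ σ : ℝ, σ ≠ 0 ∧ ∀ ρ > 0, ∃ s, |s - t| < ρ ∧ 0 < (inner ℝ P.normal (γ s) - P.offset) * σ := by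
  by_cases hup : ∀ ρ > 0, ∃ s, |s - t| < ρ ∧ 0 < inner ℝ P.normal (γ s) - P.offset
  · exact ⟨1, one_ne_zero, by simpa using hup⟩
  · push Not at hup
    obtain ⟨ρ₁, hρ₁, hle⟩ := hup
    refine ⟨-1, by norm_num, fun ρ hρ => ?_⟩
    obtain ⟨s, hs, hs0⟩ := hnd (min ρ ρ₁) (lt_min hρ hρ₁)
    refine ⟨s, hs.trans_le (min_le_left _ _), ?_⟩
    have := lt_of_le_of_ne (hle s (hs.trans_le (min_le_right _ _))) hs0
    linarith

end OneSided

/-- If at most three of six points on a plane are one-sided, the points can be lifted along the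
curve by heights proportional to their powers with respect to some sphere. -/
theorem exists_lift_heights {γ : ℝ → E3} {P : OrientedPlane} {t : Fin 6 → ℝ}
    (hplane : ∀ i, γ (t i) ∈ P.carrier)
    (hnd : ∀ i, ∀ ρ > 0, ∃ s, |s - t i| < ρ ∧ inner ℝ P.normal (γ s) - P.offset ≠ 0)
    (hside : {i : Fin 6 | P.OneSided γ (t i)}.ncard ≤ 3) :
    ∃ (κ : ℝ) (a b : E3), κ ≠ 0 ∧ ∀ i, ∀ ρ > 0,
      κ * inner ℝ (γ (t i) - a) (γ (t i) - b) = 0 ∨ ∃ s, |s - t i| < ρ ∧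
        0 < (inner ℝ P.normal (γ s) - P.offset) *
          (κ * inner ℝ (γ (t i) - a) (γ (t i) - b)) := by
  classical
  obtain ⟨F, hF, hF3⟩ := Finset.exists_superset_card_eq
    (s := {i : Fin 6 | P.OneSided γ (t i)}.toFinset) (n := 3)
    (by rwa [← Set.ncard_eq_toFinset_card']) (by simp)
  obtain ⟨j, k, l, -, -, -, rfl⟩ := Finset.card_eq_three.1 hF3
  obtain ⟨σ, hσ, hl⟩ := exists_sign_approached (hnd l)
  set q : Fin 6 → ℝ := fun i => inner ℝ (γ (t i) - γ (t j)) (γ (t i) - γ (t k)) with hq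
  obtain ⟨κ, hκ, hκl⟩ : ∃ κ : ℝ, κ ≠ 0 ∧ (κ * q l = 0 ∨ ∃ m > 0, κ * q l = m * σ) := by
    by_cases hql : q l = 0
    · exact ⟨1, one_ne_zero, Or.inl (by simp [hql])⟩
    · exact ⟨σ / q l, div_ne_zero hσ hql, Or.inr ⟨1, one_pos, by field_simp⟩⟩
  refine ⟨κ, γ (t j), γ (t k), hκ, fun i ρ hρ => ?_⟩
  change κ * q i = 0 ∨ ∃ s, |s - t i| < ρ ∧ 0 < (inner ℝ P.normal (γ s) - P.offset) * (κ * q i)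
  by_cases hi : P.OneSided γ (t i)
  · have hmem : i ∈ ({j, k, l} : Finset (Fin 6)) := hF (by simpa using hi)
    simp only [Finset.mem_insert, Finset.mem_singleton] at hmem
    rcases hmem with rfl | rfl | rfl
    · exact Or.inl (by simp [hq])
    · exact Or.inl (by simp [hq])
    · refine hκl.imp_right ?_
      rintro ⟨m, hm, hm'⟩
      obtain ⟨s, hs, hs'⟩ := hl ρ hρ
      refine ⟨s, hs, ?_⟩
      rw [hm', mul_left_comm]
      exact mul_pos hm hs'
  · rcases lt_trichotomy (κ * q i) 0 with h | h | h
    · obtain ⟨s, hs, hs'⟩ := exists_bottom_of_not_positiveOneSided (hplane i) (hnd i)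
        (fun h' => hi (Or.inl h')) hρ
      exact Or.inr ⟨s, hs, mul_pos_of_neg_of_neg hs' h⟩
    · exact Or.inl h
    · obtain ⟨s, hs, hs'⟩ := exists_top_of_not_negativeOneSided (hplane i) (hnd i)
        (fun h' => hi (Or.inr h')) hρ
      exact Or.inr ⟨s, hs, mul_pos hs' h⟩

open Filter Topology in
/-- A radius within which six cyclically ordered parameters may be perturbed freely. -/
theorem exists_perturbation_radius {γ : ℝ → E3} (hγ : Continuous γ) {t : Fin 6 → ℝ}
    (ht : StrictMono t) (ht' : t 5 < t 0 + 1) {ε r : ℝ} (hε : 0 < ε) (hr : 0 < r) :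
    ∃ ρ > 0, ∀ u : Fin 6 → ℝ, (∀ i, |u i - t i| < ρ) →
      StrictMono u ∧ u 5 < u 0 + 1 ∧ (∀ i, |u i - t i| < ε) ∧
        ∀ i, ‖γ (u i) - γ (t i)‖ < r := by
  have small : ∀ {g : ℝ}, 0 < g → ∀ᶠ ρ in 𝓝[>] (0 : ℝ), ρ < g := fun hg => by
    filter_upwards [Ioo_mem_nhdsGT hg] with ρ hρ using hρ.2
  have hgap : ∀ᶠ ρ in 𝓝[>] (0 : ℝ), ∀ i : Fin 5, ρ < (t i.succ - t i.castSucc) / 2 :=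
    eventually_all.2 fun i => small (by linarith [ht (Fin.castSucc_lt_succ (i := i))])
  have hcont : ∀ᶠ ρ in 𝓝[>] (0 : ℝ), ∀ i, ∀ s, |s - t i| < ρ → ‖γ s - γ (t i)‖ < r := by
    refine eventually_all.2 fun i => ?_
    obtain ⟨d, hd, hd'⟩ := Metric.continuous_iff.1 hγ (t i) r hr
    filter_upwards [small hd] with ρ hρ s hs
    rw [← dist_eq_norm]
    exact hd' s (lt_trans hs hρ)
  obtain ⟨ρ, hρε, hρgap, hρend, hρcont, hρ⟩ := ((small hε).and (hgap.and
    ((small (show 0 < (t 0 + 1 - t 5) / 2 by linarith)).and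
      (hcont.and self_mem_nhdsWithin)))).exists
  refine ⟨ρ, hρ, fun u hu => ⟨Fin.strictMono_iff_lt_succ.2 fun i => ?_, ?_,
    fun i => (hu i).trans hρε, fun i => hρcont i _ (hu i)⟩⟩
  · linarith [hρgap i, (abs_lt.1 (hu i.succ)).1, (abs_lt.1 (hu i.castSucc)).2]
  · linarith [(abs_lt.1 (hu 5)).2, (abs_lt.1 (hu 0)).1]

end InscribedTrefoil

open InscribedTrefoil in
theorem mainTheorem8
    (γ : ℝ → InscribedTrefoil.E3) (hγ : InscribedTrefoil.IsAnalyticKnot γ)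
    (P : InscribedTrefoil.OrientedPlane) (hγP : ∃ s, γ s ∉ P.carrier)
    (t : Fin 6 → ℝ) (ht : StrictMono t) (ht' : t 5 < t 0 + 1)
    (hplane : ∀ i, γ (t i) ∈ P.carrier)
    (hstereo : InscribedTrefoil.IsStereographicTrefoil
      fun i => InscribedTrefoil.toS3 (γ (t i)))
    (hside : {i : Fin 6 | P.OneSided γ (t i)}.ncard ≤ 3) :
    ∀ ε > 0, ∃ u : Fin 6 → ℝ, StrictMono u ∧ u 5 < u 0 + 1 ∧ (∀ i, |u i - t i| < ε) ∧
      InscribedTrefoil.IsTrefoilHexagon fun i => γ (u i) := by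
  intro ε hε
  obtain ⟨-, v, hne, hX⟩ := hstereo
  have hcont : Continuous γ := continuousOn_univ.1 hγ.analytic.continuousOn
  have hN2 : ‖P.normal‖ ^ 2 ≠ 0 := by
    have := norm_pos_iff.2 P.normal_ne_zero
    positivity
  obtain ⟨κ, a, b, hκ, hsign⟩ := exists_lift_heights hplane
    (fun i _ hρ => hγ.exists_notMem_carrier hγP (t i) hρ) hside
  set h : Fin 6 → ℝ := fun i => κ * inner ℝ (γ (t i) - a) (γ (t i) - b) with hh
  have hlift : IsTrefoilHexagon fun i => γ (t i) + (h i / ‖P.normal‖ ^ 2) • P.normal := by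
    have := hX.lift hne P.normal_ne_zero hplane (div_ne_zero hκ hN2) a b
    simpa only [hh, div_mul_eq_mul_div] using this
  obtain ⟨r, hr, hstable⟩ := hlift.exists_stable
  obtain ⟨ρ, hρ, hpert⟩ := exists_perturbation_radius hcont ht ht' hε (half_pos hr)
  have hheight : ∀ i, ∃ δ₀ > 0, ∀ δ, 0 < δ → δ ≤ δ₀ →
      ∃ u, |u - t i| < ρ ∧ inner ℝ P.normal (γ u) - P.offset = δ * h i := fun i =>
    exists_eq_mul_of_sign (η := fun s => inner ℝ P.normal (γ s) - P.offset) (by fun_prop)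
      (sub_eq_zero.2 (hplane i)) hρ (hsign i ρ hρ)
  choose δ₀ hδ₀ hu using hheight
  obtain ⟨i₀, hi₀⟩ := Finite.exists_min δ₀
  choose u hut hheight using fun i => hu i (δ₀ i₀) (hδ₀ i₀) (hi₀ i)
  obtain ⟨hmono, hlast, hclose, hγclose⟩ := hpert u hut
  refine ⟨u, hmono, hlast, hclose, ?_⟩
  have hδ : δ₀ i₀ ≠ 0 := (hδ₀ i₀).ne'
  have hstretched := hstable
    (fun i => normalStretch P.normal P.normal_ne_zero P.offset (δ₀ i₀)⁻¹ (inv_ne_zero hδ) (γ (u i)))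
    fun i => (norm_sub_normalStretch_le P.normal_ne_zero hδ (hplane i) (hheight i)).trans
      (by linarith [hγclose i])
  refine hstretched.map_edgePoint
    (normalStretch P.normal P.normal_ne_zero P.offset (δ₀ i₀)⁻¹ (inv_ne_zero hδ)).symm
    fun i s _ => ?_
  rw [Homeomorph.symm_apply_eq, normalStretch_edgePoint]
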